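/- For every $\varepsilon>0$ there is $k_0=k_0(\varepsilon)$ such that the following holds for all integers $k\ge k_0$ and all integers $\Delta\ge 0$ with $\Delta\le(1-\varepsilon)k\ln k$. Let $G$ be a finite triangle-free simple graph of maximum degree at most $\Delta$. Then $G$ has a proper $k$-colouring, and if $\boldsymbol\sigma$ is a uniformly random proper $k$-colouring of $G$, then for every vertex $v$ of $G$, with probability at least $1-\mathrm{e}^{-\Delta^{\varepsilon/3}}$ (where $0^{\varepsilon/3}=0$), all of the following hold simultaneously: 1. $v$ is $(\Delta+1)$-loose in $\boldsymbol\sigma$: for every colour $j\in[k]$ with $j\ne\boldsymbol\sigma(v)$ there is a proper $k$-colouring $\sigma'$ of $G$ with $\sigma'(v)=j$ that differs from $\boldsymbol\sigma$ on at most $\Delta+1$ vertices; 2. $v$ is thawed in $\boldsymbol\sigma$: for every $j\in[k]$ there is a finite sequence of proper $k$-colourings of $G$, starting at $\boldsymbol\sigma$ and ending at a colouring that gives $v$ the colour $j$, in which any two consecutive colourings differ on at most one vertex; 3. moreover, for every $j\in[k]$ there is a sequence as in 2 in which only $v$ and its neighbours ever change colour. -/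

import Mathlib

namespace ColouringGeometry

variable {V : Type*} [Fintype V]

/-- The distance-`t` `k`-colouring graph: its vertices are the proper `k`-colourings of `G`, and two
distinct proper colourings are adjacent if they differ on at most `t` vertices of `G`. -/
def colouringGraph (G : SimpleGraph V) (k t : ℕ) : SimpleGraph (G.Coloring (Fin k)) where
  Adj τ σ := τ ≠ σ ∧ hammingDist (fun v => τ v) (fun v => σ v) ≤ t
  symm := ⟨fun τ σ h => ⟨h.1.symm, by rw [hammingDist_comm]; exact h.2⟩⟩
  loopless := ⟨fun _ h => h.1 rfl⟩

/-- `v` is `t`-loose in `τ`: for every colour `j` other than the one `v` already has, some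
neighbour of `τ` in the distance-`t` colouring graph gives `v` the colour `j`. (For `j = τ v` the
colouring `τ` itself serves, at distance `0`.) -/
def IsLoose (G : SimpleGraph V) (k t : ℕ) (τ : G.Coloring (Fin k)) (v : V) : Prop :=
  ∀ j : Fin k, j ≠ τ v → ∃ σ : G.Coloring (Fin k), (colouringGraph G k t).Adj τ σ ∧ σ v = j

/-- `v` is `t`-thawed in `τ`: every colour is taken by `v` in some colouring of the `t`-cluster
(connected component of the distance-`t` colouring graph) of `τ`. -/
def IsThawed (G : SimpleGraph V) (k t : ℕ) (τ : G.Coloring (Fin k)) (v : V) : Prop :=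
  ∀ j : Fin k, ∃ σ : G.Coloring (Fin k),
    (colouringGraph G k t).connectedComponentMk σ
      = (colouringGraph G k t).connectedComponentMk τ ∧ σ v = j

/-- `v` can be given any colour by recolouring, one vertex at a time and through proper colourings,
only `v` and its neighbours: along some walk of single-vertex recolourings, no vertex outside the
closed neighbourhood of `v` ever changes colour. -/
def IsLocallyRecolourable (G : SimpleGraph V) (k : ℕ) (τ : G.Coloring (Fin k)) (v : V) : Prop :=
  ∀ j : Fin k, ∃ (σ : G.Coloring (Fin k)) (w : (colouringGraph G k 1).Walk τ σ), σ v = j ∧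
    ∀ ρ ∈ w.support, ∀ u : V, u ≠ v → ¬ G.Adj v u → ρ u = τ u

open scoped Classical in
/-- The law of the uniformly random proper `k`-colouring of `G`. -/
noncomputable def uniformColouring (G : SimpleGraph V) (k : ℕ) [Nonempty (G.Coloring (Fin k))] :
    PMF (G.Coloring (Fin k)) :=
  haveI : Finite (G.Coloring (Fin k)) := DFunLike.finite _
  haveI : Fintype (G.Coloring (Fin k)) := Fintype.ofFinite _
  PMF.uniformOfFintype (G.Coloring (Fin k))

/-- The probability that the uniformly random proper `k`-colouring of `G` lies in `E`. -/
noncomputable def colouringProb (G : SimpleGraph V) (k : ℕ) [Nonempty (G.Coloring (Fin k))]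
    (E : Set (G.Coloring (Fin k))) : ℝ :=
  ((uniformColouring G k).toOuterMeasure E).toReal

end ColouringGeometry

/-!
If `τ` is a uniformly random proper colouring, resampling the colour of a vertex `u` uniformly
among the colours that `τ` gives to no neighbour of `u` leaves its law unchanged. In a
triangle-free graph the neighbours of a vertex `v` are pairwise non-adjacent, so they can be
resampled independently of each other. They therefore act on the set of colours like at most `Δ`
coupon collectors drawing from lists of their own. Their total mass on all colours is at most `Δ`,
so if few of the lists are short then by convexity they miss, on average, about
`k exp (-Δ / k) ≥ k ^ ε` colours, and as the events of missing different colours are negatively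
correlated, hardly ever fewer than two. Adding the vertices of the graph one at a time shows by
induction that lists are long on average and rarely short.

With overwhelming probability, then, every neighbour of `v` has at least two available colours. To
give `v` the colour `j`, let each neighbour that has the colour `j` step aside to another one.
-/

namespace ColouringGeometry

open Finset
open scoped BigOperators

section Inequalities

variable {ι C : Type*}

lemma expect_const_le (s : Finset ι) {a : ℝ} (ha : 0 ≤ a) : 𝔼 _i ∈ s, a ≤ a := by
  rcases s.eq_empty_or_nonempty with rfl | hs
  · simpa using ha
  · exact (expect_const hs a).le

lemma prod_add_sum_mul_prod_erase_le {R : Type*} [CommSemiring R] [PartialOrder R]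
    [IsOrderedRing R] [DecidableEq ι] (s : Finset ι) {y z : ι → R} (hy : ∀ i, 0 ≤ y i)
    (hz : ∀ i, 0 ≤ z i) :
    ∏ i ∈ s, y i + ∑ i ∈ s, z i * ∏ j ∈ s.erase i, y j ≤ ∏ i ∈ s, (y i + z i) := by
  induction s using Finset.induction_on with
  | empty => simp
  | insert a s ha ih =>
    have hsum : ∑ i ∈ s, z i * ∏ j ∈ (insert a s).erase i, y j =
        y a * ∑ i ∈ s, z i * ∏ j ∈ s.erase i, y j := by
      rw [mul_sum]
      refine sum_congr rfl fun i hi => ?_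
      rw [erase_insert_of_ne (ne_of_mem_of_not_mem hi ha).symm,
        prod_insert fun h => ha (mem_of_mem_erase h), mul_left_comm]
    have hprod : ∏ i ∈ s, y i ≤ ∏ i ∈ s, (y i + z i) :=
      prod_le_prod (fun i _ => hy i) fun i _ => le_add_of_nonneg_right (hz i)
    calc ∏ i ∈ insert a s, y i + ∑ i ∈ insert a s, z i * ∏ j ∈ (insert a s).erase i, y j
        = y a * (∏ i ∈ s, y i + ∑ i ∈ s, z i * ∏ j ∈ s.erase i, y j) + z a * ∏ i ∈ s, y i := by
          rw [prod_insert ha, sum_insert ha, erase_insert ha, hsum]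
          ring
      _ ≤ y a * ∏ i ∈ s, (y i + z i) + z a * ∏ i ∈ s, (y i + z i) :=
          add_le_add (mul_le_mul_of_nonneg_left ih (hy a))
            (mul_le_mul_of_nonneg_left hprod (hz a))
      _ = ∏ i ∈ insert a s, (y i + z i) := by rw [prod_insert ha, add_mul]

lemma sum_mul_prod_one_sub_ite_le [Fintype C] [DecidableEq C] {p b : C → ℝ}
    (hp : ∀ c, 0 ≤ p c) (hp1 : ∑ c, p c = 1) (hb0 : ∀ c, 0 ≤ b c) (hb1 : ∀ c, b c ≤ 1) :
    ∑ x, p x * ∏ c, (1 - if x = c then 0 else b c) ≤ ∏ c, (1 - b c * (1 - p c)) := by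
  have hterm : ∀ x, p x * ∏ c, (1 - if x = c then 0 else b c) =
      p x * ∏ c, (1 - b c) + p x * b x * ∏ c ∈ univ.erase x, (1 - b c) := by
    intro x
    have herase : ∏ c ∈ univ.erase x, (1 - if x = c then 0 else b c) =
        ∏ c ∈ univ.erase x, (1 - b c) :=
      prod_congr rfl fun c hc => by rw [if_neg (ne_of_mem_erase hc).symm]
    rw [← mul_prod_erase univ _ (mem_univ x), ← mul_prod_erase univ _ (mem_univ x), herase,
      if_pos rfl]
    ring
  calc ∑ x, p x * ∏ c, (1 - if x = c then 0 else b c)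
      = ∏ c, (1 - b c) + ∑ x, p x * b x * ∏ c ∈ univ.erase x, (1 - b c) := by
        simp_rw [hterm, sum_add_distrib, ← sum_mul, hp1, one_mul]
    _ ≤ ∏ c, ((1 - b c) + p c * b c) :=
        prod_add_sum_mul_prod_erase_le univ (fun c => sub_nonneg.2 (hb1 c))
          fun c => mul_nonneg (hp c) (hb0 c)
    _ = ∏ c, (1 - b c * (1 - p c)) := prod_congr rfl fun c _ => by ring

lemma mul_exp_neg_div_le_sum_exp_neg (s : Finset ι) (x : ι → ℝ) {n X : ℝ} (hn : 0 < n)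
    (hns : n ≤ #s) (hX : 0 ≤ X) (hxX : ∑ i ∈ s, x i ≤ X) :
    n * Real.exp (-(X / n)) ≤ ∑ i ∈ s, Real.exp (-x i) := by
  -- The graph of `exp` lies above its tangent line at `-(X / n)`.
  have htangent : ∀ i, Real.exp (-(X / n)) * (1 + X / n - x i) ≤ Real.exp (-x i) := by
    intro i
    calc Real.exp (-(X / n)) * (1 + X / n - x i)
        ≤ Real.exp (-(X / n)) * Real.exp (X / n - x i) := by
          gcongr
          linarith [Real.add_one_le_exp (X / n - x i)]
      _ = Real.exp (-x i) := by
          rw [← Real.exp_add]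
          congr 1
          ring
  calc n * Real.exp (-(X / n)) = Real.exp (-(X / n)) * (n * (1 + X / n) - X) := by
        field_simp
        ring
    _ ≤ Real.exp (-(X / n)) * (#s * (1 + X / n) - ∑ i ∈ s, x i) := by gcongr
    _ = ∑ i ∈ s, Real.exp (-(X / n)) * (1 + X / n - x i) := by
        rw [← mul_sum, sum_sub_distrib, sum_const, nsmul_eq_mul]
    _ ≤ ∑ i ∈ s, Real.exp (-x i) := sum_le_sum fun i _ => htangent i

end Inequalities

section Lists

variable {ι C : Type*} [DecidableEq C]

/-- The mass that the uniform distribution on the list of colours `L` gives to the colour `c`. -/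
noncomputable def uniformMass (L : Finset C) (c : C) : ℝ := if c ∈ L then (#L : ℝ)⁻¹ else 0

lemma uniformMass_nonneg (L : Finset C) (c : C) : 0 ≤ uniformMass L c := by
  unfold uniformMass
  positivity

lemma uniformMass_le_one (L : Finset C) (c : C) : uniformMass L c ≤ 1 := by
  unfold uniformMass
  split_ifs
  exacts [Nat.cast_inv_le_one _, zero_le_one]

lemma prod_one_sub_uniformMass_nonneg (A : Finset ι) (L : ι → Finset C) (c : C) :
    0 ≤ ∏ u ∈ A, (1 - uniformMass (L u) c) :=
  prod_nonneg fun _ _ => sub_nonneg.2 (uniformMass_le_one _ _)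

lemma prod_one_sub_uniformMass_le_one (A : Finset ι) (L : ι → Finset C) (c : C) :
    ∏ u ∈ A, (1 - uniformMass (L u) c) ≤ 1 :=
  prod_le_one (fun _ _ => sub_nonneg.2 (uniformMass_le_one _ _))
    fun _ _ => sub_le_self _ (uniformMass_nonneg _ _)

lemma exp_neg_mul_uniformMass_le {t : ℕ} (ht : 1 ≤ t) {L : Finset C} {c : C}
    (hc : #L ≤ t → c ∉ L) :
    Real.exp (-((1 + (t : ℝ)⁻¹) * uniformMass L c)) ≤ 1 - uniformMass L c := by
  by_cases hcL : c ∈ L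
  · have ht0 : (1 : ℝ) ≤ t := by exact_mod_cast ht
    have htL : (t : ℝ) + 1 ≤ #L := by exact_mod_cast not_le.1 fun h => hc h hcL
    have hbound : 1 ≤ (1 - (#L : ℝ)⁻¹) * (1 + (1 + (t : ℝ)⁻¹) * (#L : ℝ)⁻¹) := by
      have hL0 : (0 : ℝ) < #L := by linarith
      field_simp
      nlinarith
    have hexp := Real.add_one_le_exp ((1 + (t : ℝ)⁻¹) * (#L : ℝ)⁻¹)
    have hL1 : 0 ≤ 1 - (#L : ℝ)⁻¹ := sub_nonneg.2 (Nat.cast_inv_le_one _)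
    rw [uniformMass, if_pos hcL, Real.exp_neg, inv_le_iff_one_le_mul₀ (Real.exp_pos _)]
    exact hbound.trans (by gcongr; linarith)
  · simp [uniformMass, hcL]

variable [Fintype C]

lemma sum_uniformMass_mul (L : Finset C) (h : C → ℝ) :
    ∑ c, uniformMass L c * h c = 𝔼 c ∈ L, h c := by
  simp only [uniformMass, ite_mul, zero_mul, sum_ite_mem, univ_inter]
  rw [← mul_sum, expect_eq_sum_div_card, div_eq_inv_mul]

lemma sum_uniformMass {L : Finset C} (hL : L.Nonempty) : ∑ c, uniformMass L c = 1 := by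
  simpa [expect_const hL] using sum_uniformMass_mul L 1

lemma sum_uniformMass_le_one (L : Finset C) : ∑ c, uniformMass L c ≤ 1 := by
  rcases L.eq_empty_or_nonempty with rfl | hL
  · simp [uniformMass]
  · exact (sum_uniformMass hL).le

lemma card_le_card_filter_add_mul_card_filter (A : Finset ι) (L : ι → Finset C) (t : ℕ) :
    Fintype.card C ≤
      #{c | ∀ u ∈ A, #(L u) ≤ t → c ∉ L u} + #{u ∈ A | #(L u) ≤ t} * t := by
  rw [← card_univ, ← card_filter_add_card_filter_not fun c => ∀ u ∈ A, #(L u) ≤ t → c ∉ L u]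
  gcongr
  refine (card_le_card fun c hc => ?_).trans
    (card_biUnion_le_card_mul _ L t fun u hu => (mem_filter.1 hu).2)
  simpa [and_assoc] using hc

/-- If few of the lists are short, few colours lie in a short list; on the other colours the
average of `∑ u ∈ A, uniformMass (L u) c` is at most `#A / n`. -/
lemma mul_exp_le_sum_prod_one_sub_uniformMass {t : ℕ} (ht : 1 ≤ t) {n d : ℝ} (hn : 0 < n)
    {A : Finset ι} (hA : #A ≤ d) (L : ι → Finset C)
    (hshort : #{u ∈ A | #(L u) ≤ t} * t ≤ Fintype.card C - n) :
    n * Real.exp (-(d * (1 + (t : ℝ)⁻¹) / n)) ≤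
      ∑ c, ∏ u ∈ A, (1 - uniformMass (L u) c) := by
  set F : Finset C := {c | ∀ u ∈ A, #(L u) ≤ t → c ∉ L u}
  have hcard : n ≤ #F := by
    have : (Fintype.card C : ℝ) ≤ #F + #{u ∈ A | #(L u) ≤ t} * t := by
      exact_mod_cast card_le_card_filter_add_mul_card_filter A L t
    linarith
  have hmass : ∑ c ∈ F, (1 + (t : ℝ)⁻¹) * ∑ u ∈ A, uniformMass (L u) c ≤
      d * (1 + (t : ℝ)⁻¹) := by
    rw [← mul_sum, mul_comm d]
    gcongr
    calc ∑ c ∈ F, ∑ u ∈ A, uniformMass (L u) c ≤ ∑ c, ∑ u ∈ A, uniformMass (L u) c :=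
          sum_le_univ_sum_of_nonneg fun c => sum_nonneg fun u _ => uniformMass_nonneg _ _
      _ = ∑ u ∈ A, ∑ c, uniformMass (L u) c := sum_comm
      _ ≤ ∑ u ∈ A, 1 := sum_le_sum fun u _ => sum_uniformMass_le_one _
      _ ≤ d := by simpa using hA
  have hd : 0 ≤ d := (Nat.cast_nonneg _).trans hA
  calc n * Real.exp (-(d * (1 + (t : ℝ)⁻¹) / n))
      ≤ ∑ c ∈ F, Real.exp (-((1 + (t : ℝ)⁻¹) * ∑ u ∈ A, uniformMass (L u) c)) :=
        mul_exp_neg_div_le_sum_exp_neg F _ hn hcard (by positivity) hmass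
    _ ≤ ∑ c ∈ F, ∏ u ∈ A, (1 - uniformMass (L u) c) := by
        refine sum_le_sum fun c hc => ?_
        rw [mul_sum, ← sum_neg_distrib, Real.exp_sum]
        exact prod_le_prod (fun u _ => (Real.exp_pos _).le) fun u hu =>
          exp_neg_mul_uniformMass_le ht ((mem_filter.1 hc).2 u hu)
    _ ≤ ∑ c, ∏ u ∈ A, (1 - uniformMass (L u) c) :=
        sum_le_univ_sum_of_nonneg fun c => prod_one_sub_uniformMass_nonneg A L c

lemma prod_one_sub_half_mul_prod_le {t : ℕ} (ht : 1 ≤ t) {n d : ℝ} (hn : 0 < n)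
    {A : Finset ι} (hA : #A ≤ d) (L : ι → Finset C)
    (hshort : #{u ∈ A | #(L u) ≤ t} * t ≤ Fintype.card C - n) :
    ∏ c, (1 - 1 / 2 * ∏ u ∈ A, (1 - uniformMass (L u) c)) ≤
      Real.exp (-(n * Real.exp (-(d * (1 + (t : ℝ)⁻¹) / n)) / 2)) := by
  calc ∏ c, (1 - 1 / 2 * ∏ u ∈ A, (1 - uniformMass (L u) c))
      ≤ ∏ c, Real.exp (-(1 / 2 * ∏ u ∈ A, (1 - uniformMass (L u) c))) :=
        prod_le_prod (fun c _ => by linarith [prod_one_sub_uniformMass_le_one A L c])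
          fun c _ => Real.one_sub_le_exp_neg _
    _ = Real.exp (-((∑ c, ∏ u ∈ A, (1 - uniformMass (L u) c)) / 2)) := by
        rw [← Real.exp_sum, sum_neg_distrib, ← mul_sum, one_div_mul_eq_div]
    _ ≤ Real.exp (-(n * Real.exp (-(d * (1 + (t : ℝ)⁻¹) / n)) / 2)) := by
        gcongr
        exact mul_exp_le_sum_prod_one_sub_uniformMass ht hn hA L hshort

lemma prod_one_sub_half_mul_prod_le_add {t : ℕ} (ht : 1 ≤ t) {n d : ℝ} (hn : 0 < n)
    {A : Finset ι} (hA : #A ≤ d) (L : ι → Finset C) :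
    ∏ c, (1 - 1 / 2 * ∏ u ∈ A, (1 - uniformMass (L u) c)) ≤
      Real.exp (-(n * Real.exp (-(d * (1 + (t : ℝ)⁻¹) / n)) / 2)) +
        2 ^ #{u ∈ A | #(L u) ≤ t} * 2 ^ (-((Fintype.card C - n) / t)) := by
  have ht0 : (0 : ℝ) < t := by exact_mod_cast ht
  rcases le_or_gt (#{u ∈ A | #(L u) ≤ t} * t : ℝ) (Fintype.card C - n) with hshort | hshort
  · exact (prod_one_sub_half_mul_prod_le ht hn hA L hshort).trans
      (le_add_of_nonneg_right (by positivity))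
  · refine le_add_of_nonneg_of_le (Real.exp_pos _).le ?_
    calc ∏ c, (1 - 1 / 2 * ∏ u ∈ A, (1 - uniformMass (L u) c)) ≤ 1 :=
          prod_le_one (fun c _ => by linarith [prod_one_sub_uniformMass_le_one A L c])
            fun c _ => by linarith [prod_one_sub_uniformMass_nonneg A L c]
      _ ≤ (2 : ℝ) ^ (#{u ∈ A | #(L u) ≤ t} + -((Fintype.card C - n) / t) : ℝ) := by
          refine Real.one_le_rpow one_le_two ?_
          rw [← sub_eq_add_neg, sub_nonneg, div_le_iff₀ ht0]
          exact hshort.le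
      _ = 2 ^ #{u ∈ A | #(L u) ≤ t} * 2 ^ (-((Fintype.card C - n) / t)) := by
          rw [Real.rpow_add two_pos, Real.rpow_natCast]

end Lists

section PartialColourings

lemma sum_sum_update {V C M : Type*} [Fintype V] [DecidableEq V] [Fintype C] [AddCommMonoid M]
    (u : V) (F : (V → C) → M) :
    ∑ f, ∑ x, F (Function.update f u x) = Fintype.card C • ∑ f, F f := by
  calc ∑ f, ∑ x, F (Function.update f u x)
      = ∑ p : (V → C) × C, F (Function.update p.1 u p.2) :=
        (Fintype.sum_prod_type' fun f x => F (Function.update f u x)).symm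
    _ = ∑ p : (V → C) × C, F p.1 :=
        sum_nbij' (fun p => (Function.update p.1 u p.2, p.1 u))
          (fun p => (Function.update p.1 u p.2, p.1 u)) (by simp) (by simp) (by simp) (by simp)
          (by simp)
    _ = Fintype.card C • ∑ f, F f := by
        rw [Fintype.sum_prod_type, smul_sum]
        simp

variable {V : Type*} (G : SimpleGraph V) [DecidableRel G.Adj] {C : Type*} [Fintype C]
  [DecidableEq C]

/-- The list of colours available to `v`: those that `f` gives to no neighbour of `v` in `S`. -/
def available (S : Finset V) (v : V) (f : V → C) : Finset C :=
  {c | ∀ w ∈ S, G.Adj v w → f w ≠ c}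

variable (C) in
/-- The colourings of `V` that are proper on `S`. They are arbitrary outside `S`, so that the
uniform distributions for different `S` live on the same space `V → C`. -/
def properOn [Fintype V] [DecidableEq V] (S : Finset V) : Finset (V → C) :=
  {f | ∀ u ∈ S, ∀ w ∈ S, G.Adj u w → f u ≠ f w}

variable {G} {S T : Finset V} {u v : V} {f : V → C} {x : C}

lemma mem_available : x ∈ available G S v f ↔ ∀ w ∈ S, G.Adj v w → f w ≠ x := by
  simp [available]

variable [DecidableEq V]

lemma available_insert (huv : ¬ G.Adj v u) (f : V → C) :
    available G (insert u T) v f = available G T v f := by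
  ext c
  simp [mem_available, huv]

lemma available_update (huv : ¬ G.Adj v u) (f : V → C) (x : C) :
    available G S v (Function.update f u x) = available G S v f := by
  ext c
  simp only [mem_available]
  refine forall₃_congr fun w _ hvw => ?_
  rw [Function.update_of_ne (ne_of_apply_ne (G.Adj v) fun h => huv (h ▸ hvw))]

lemma two_pow_card_filter_insert {A : Finset V} (hu : u ∉ A) (hA : ∀ w ∈ A, ¬ G.Adj w u) (t : ℕ)
    (f : V → C) :
    (2 : ℝ) ^ #{w ∈ insert u A | #(available G (insert u T) w f) ≤ t} =
      2 ^ #{w ∈ A | #(available G T w f) ≤ t} +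
        if #(available G T u f) ≤ t then 2 ^ #{w ∈ A | #(available G T w f) ≤ t} else 0 := by
  rw [filter_insert, available_insert G.irrefl,
    filter_congr fun w hw => by rw [available_insert (hA w hw)]]
  split_ifs
  · rw [card_insert_of_notMem (by simp [hu]), pow_succ, mul_two]
  · rw [add_zero]

variable [Fintype V]

lemma mem_properOn : f ∈ properOn G C S ↔ ∀ u ∈ S, ∀ w ∈ S, G.Adj u w → f u ≠ f w := by
  simp [properOn]

lemma mem_properOn_insert :
    f ∈ properOn G C (insert u T) ↔ f ∈ properOn G C T ∧ f u ∈ available G T u f := by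
  simp only [mem_properOn, mem_available, forall_mem_insert, G.irrefl, false_imp_iff, true_and]
  refine ⟨fun h => ⟨fun w hw => (h.2 w hw).2, fun w hw huw => (h.1 w hw huw).symm⟩,
    fun h => ⟨fun w hw huw => (h.2 w hw huw).symm,
      fun w hw => ⟨fun hwu => h.2 w hw hwu.symm, h.1 w hw⟩⟩⟩

lemma update_mem_properOn (hu : u ∉ T) :
    Function.update f u x ∈ properOn G C T ↔ f ∈ properOn G C T := by
  simp only [mem_properOn]
  refine forall₂_congr fun w hw => forall₃_congr fun w' hw' _ => ?_
  rw [Function.update_of_ne (ne_of_mem_of_not_mem hw hu),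
    Function.update_of_ne (ne_of_mem_of_not_mem hw' hu)]

lemma update_mem_properOn_insert (hu : u ∉ T) :
    Function.update f u x ∈ properOn G C (insert u T) ↔
      f ∈ properOn G C T ∧ x ∈ available G T u f := by
  rw [mem_properOn_insert, update_mem_properOn hu, available_update G.irrefl,
    Function.update_self]

lemma card_smul_sum_properOn_insert {M : Type*} [AddCommMonoid M] (hu : u ∉ T)
    (h : (V → C) → M) :
    Fintype.card C • ∑ f ∈ properOn G C (insert u T), h f =
      ∑ f ∈ properOn G C T, ∑ x ∈ available G T u f, h (Function.update f u x) := by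
  rw [← Fintype.sum_ite_mem, ← sum_sum_update u, ← Fintype.sum_ite_mem]
  simp only [update_mem_properOn_insert hu, ite_and, sum_ite_irrel, Fintype.sum_ite_mem,
    sum_const_zero]

/-- Colouring `T` at random and then `u` with a random available colour is not uniform on
`insert u T`: it has to be reweighted by the number of available colours. -/
lemma expect_card_available_mul_expect (hu : u ∉ T) {h : (V → C) → ℝ}
    (hh : ∀ f x, h (Function.update f u x) = h f) :
    (𝔼 f ∈ properOn G C T, (#(available G T u f) : ℝ)) * 𝔼 f ∈ properOn G C (insert u T), h f =
      𝔼 f ∈ properOn G C T, #(available G T u f) * h f := by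
  have hsum : ∀ g : (V → C) → ℝ, (∀ f x, g (Function.update f u x) = g f) →
      ∑ f ∈ properOn G C T, #(available G T u f) * g f =
        Fintype.card C * ∑ f ∈ properOn G C (insert u T), g f := by
    intro g hg
    rw [← nsmul_eq_mul, card_smul_sum_properOn_insert hu]
    simp_rw [hg, sum_const, nsmul_eq_mul]
  have hcard := hsum 1 fun _ _ => rfl
  simp only [Pi.one_apply, mul_one, sum_const, nsmul_eq_mul] at hcard
  simp only [expect_eq_sum_div_card, hsum h hh, hcard]
  rcases (properOn G C (insert u T)).eq_empty_or_nonempty with hempty | hne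
  · simp [hempty]
  · have : (#(properOn G C (insert u T)) : ℝ) ≠ 0 := by simpa using hne.ne_empty
    field_simp

/-- The uniform distribution on `properOn G C S` is stationary for the heat-bath dynamics. -/
lemma expect_expect_available_update (hu : u ∈ S) (h : (V → C) → ℝ) :
    𝔼 f ∈ properOn G C S, 𝔼 x ∈ available G S u f, h (Function.update f u x) =
      𝔼 f ∈ properOn G C S, h f := by
  rcases isEmpty_or_nonempty (V → C) with hempty | ⟨⟨f₀⟩⟩
  · simp [eq_empty_of_isEmpty (properOn G C S)]
  obtain ⟨T, huT, rfl⟩ : ∃ T, u ∉ T ∧ insert u T = S :=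
    ⟨S.erase u, notMem_erase u S, insert_erase hu⟩
  have hcard : Fintype.card C ≠ 0 := (Fintype.card_pos_iff.2 ⟨f₀ u⟩).ne'
  rw [expect_eq_sum_div_card, expect_eq_sum_div_card]
  congr 1
  refine smul_right_injective ℝ hcard ?_
  simp only [available_insert G.irrefl, card_smul_sum_properOn_insert huT,
    available_update G.irrefl, Function.update_idem, sum_const, card_smul_expect]

end PartialColourings

section RandomColourings

variable {V : Type*} [Fintype V] [DecidableEq V] {G : SimpleGraph V} [DecidableRel G.Adj]
  {C : Type*} [Fintype C] [DecidableEq C] {S T A : Finset V} {u v : V}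

lemma expect_prod_one_sub_ite_eq_le (hu : u ∈ S) (b : (V → C) → C → ℝ)
    (hb : ∀ f x, b (Function.update f u x) = b f) (hb0 : ∀ f c, 0 ≤ b f c)
    (hb1 : ∀ f c, b f c ≤ 1) :
    𝔼 f ∈ properOn G C S, ∏ c, (1 - if f u = c then 0 else b f c) ≤
      𝔼 f ∈ properOn G C S, ∏ c, (1 - b f c * (1 - uniformMass (available G S u f) c)) := by
  rw [← expect_expect_available_update hu]
  refine expect_le_expect fun f hf => ?_
  simp only [Function.update_self, hb]
  rw [← sum_uniformMass_mul]
  have hfu : f u ∈ available G S u f :=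
    mem_available.2 fun w hw huw => (mem_properOn.1 hf u hu w hw huw).symm
  exact sum_mul_prod_one_sub_ite_le (uniformMass_nonneg _) (sum_uniformMass ⟨f u, hfu⟩) (hb0 f)
    (hb1 f)

/-- The vertices of `A` are resampled one at a time, as if they chose their colours independently
from their lists; `b f c` collects the factors of those already resampled. -/
lemma expect_prod_one_sub_ite_forall_le (hA : G.IsIndepSet A) (hAS : A ⊆ S)
    (b : (V → C) → C → ℝ) (hb : ∀ u ∈ A, ∀ f x, b (Function.update f u x) = b f)
    (hb0 : ∀ f c, 0 ≤ b f c) (hb1 : ∀ f c, b f c ≤ 1) :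
    𝔼 f ∈ properOn G C S, ∏ c, (1 - if ∀ u ∈ A, f u ≠ c then b f c else 0) ≤
      𝔼 f ∈ properOn G C S,
        ∏ c, (1 - b f c * ∏ u ∈ A, (1 - uniformMass (available G S u f) c)) := by
  induction A using Finset.induction_on generalizing b with
  | empty => simp
  | insert u A hu ih =>
    rw [insert_subset_iff] at hAS
    have huA : ∀ w ∈ A, ¬ G.Adj w u := fun w hw =>
      hA (by simp [hw]) (by simp) (ne_of_mem_of_not_mem hw hu)
    set q : (V → C) → C → ℝ := fun f c => ∏ w ∈ A, (1 - uniformMass (available G S w f) c)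
    have hq : ∀ f x, q (Function.update f u x) = q f := fun f x =>
      funext fun c => prod_congr rfl fun w hw => by rw [available_update (huA w hw)]
    calc 𝔼 f ∈ properOn G C S, ∏ c, (1 - if ∀ w ∈ insert u A, f w ≠ c then b f c else 0)
        = 𝔼 f ∈ properOn G C S,
            ∏ c, (1 - if ∀ w ∈ A, f w ≠ c then if f u = c then 0 else b f c else 0) := by
          refine expect_congr rfl fun f _ => prod_congr rfl fun c _ => ?_
          by_cases hfu : f u = c <;> simp [hfu]
      _ ≤ 𝔼 f ∈ properOn G C S, ∏ c, (1 - (if f u = c then 0 else b f c) * q f c) := by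
          refine ih (hA.mono (by simp)) hAS.2 (fun f c => if f u = c then 0 else b f c)
            (fun w hw f x => ?_) (fun f c => ?_) fun f c => ?_
          · simp only [hb w (mem_insert_of_mem hw),
              Function.update_of_ne (ne_of_mem_of_not_mem hw hu).symm]
          · exact ite_nonneg le_rfl (hb0 f c)
          · exact ite_le_one zero_le_one (hb1 f c)
      _ = 𝔼 f ∈ properOn G C S, ∏ c, (1 - if f u = c then 0 else b f c * q f c) := by
          simp only [ite_mul, zero_mul]
      _ ≤ 𝔼 f ∈ properOn G C S,
            ∏ c, (1 - b f c * q f c * (1 - uniformMass (available G S u f) c)) := by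
          refine expect_prod_one_sub_ite_eq_le hAS.1 (fun f c => b f c * q f c) (fun f x => ?_)
            (fun f c => mul_nonneg (hb0 f c) (prod_one_sub_uniformMass_nonneg _ _ _))
            fun f c => mul_le_one₀ (hb1 f c) (prod_one_sub_uniformMass_nonneg _ _ _)
              (prod_one_sub_uniformMass_le_one _ _ _)
          simp only [hb u (mem_insert_self u A), hq]
      _ = _ := by
          refine expect_congr rfl fun f _ => prod_congr rfl fun c _ => ?_
          rw [prod_insert hu, mul_assoc, mul_comm (q f c)]

variable (G C) in
/-- For every `u` and `T` with `insert u T ⊆ S`, the uniformly random colouring proper on `T`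
leaves, on average, at least `l` colours available to `u`. -/
def HasMeanAvailable (l : ℝ) (S : Finset V) : Prop :=
  ∀ T u, u ∉ T → insert u T ⊆ S → l ≤ 𝔼 f ∈ properOn G C T, (#(available G T u f) : ℝ)

variable {l : ℝ}

lemma HasMeanAvailable.mono (h : HasMeanAvailable G C l S) (hTS : T ⊆ S) :
    HasMeanAvailable G C l T :=
  fun _ _ huT' hT' => h _ _ huT' (hT'.trans hTS)

lemma HasMeanAvailable.properOn_nonempty [Nonempty C] (h : HasMeanAvailable G C l S)
    (hl : 0 < l) : (properOn G C S).Nonempty := by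
  rcases S.eq_empty_or_nonempty with rfl | ⟨u, hu⟩
  · exact ⟨fun _ => Classical.arbitrary C, by simp [mem_properOn]⟩
  · have hpos := hl.trans_le (h (S.erase u) u (notMem_erase u S) (insert_erase hu).subset)
    obtain ⟨f, hf, havail⟩ := exists_ne_zero_of_expect_ne_zero hpos.ne'
    obtain ⟨x, hx⟩ := card_ne_zero.1 (Nat.cast_ne_zero.1 havail)
    rw [← insert_erase hu]
    exact ⟨Function.update f u x,
      (update_mem_properOn_insert (notMem_erase u S)).2 ⟨hf, hx⟩⟩

lemma HasMeanAvailable.mul_expect_le (h : HasMeanAvailable G C l (insert u T)) (hu : u ∉ T)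
    {X : (V → C) → ℝ} (hX0 : ∀ f, 0 ≤ X f) (hX : ∀ f x, X (Function.update f u x) = X f) :
    l * 𝔼 f ∈ properOn G C (insert u T), X f ≤
      𝔼 f ∈ properOn G C T, #(available G T u f) * X f := by
  rw [← expect_card_available_mul_expect hu hX]
  exact mul_le_mul_of_nonneg_right (h T u hu subset_rfl) (expect_nonneg fun f _ => hX0 f)

lemma HasMeanAvailable.expect_ite_card_le (h : HasMeanAvailable G C l (insert u T)) (hl : 0 < l)
    (hu : u ∉ T) (t : ℕ) {X : (V → C) → ℝ} (hX0 : ∀ f, 0 ≤ X f)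
    (hX : ∀ f x, X (Function.update f u x) = X f) :
    𝔼 f ∈ properOn G C (insert u T), (if #(available G T u f) ≤ t then X f else 0) ≤
      t / l * 𝔼 f ∈ properOn G C T, X f := by
  rw [div_mul_eq_mul_div, le_div_iff₀' hl, mul_expect (properOn G C T)]
  refine (h.mul_expect_le hu (fun f => ite_nonneg (hX0 f) le_rfl) fun f x => ?_).trans ?_
  · rw [hX, available_update G.irrefl]
  · refine expect_le_expect fun f _ => ?_
    split_ifs with ht
    · exact mul_le_mul_of_nonneg_right (by exact_mod_cast ht) (hX0 f)
    · simpa using mul_nonneg t.cast_nonneg (hX0 f)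

lemma HasMeanAvailable.expect_two_pow_card_le (h : HasMeanAvailable G C l S) (hl : 0 < l)
    (hA : G.IsIndepSet A) (hAS : A ⊆ S) (t : ℕ) :
    𝔼 f ∈ properOn G C S, (2 : ℝ) ^ #{u ∈ A | #(available G S u f) ≤ t} ≤ (1 + t / l) ^ #A := by
  induction A using Finset.induction_on generalizing S with
  | empty => simpa using expect_const_le (properOn G C S) zero_le_one
  | insert u A hu ih =>
    obtain ⟨T, huT, rfl⟩ : ∃ T, u ∉ T ∧ insert u T = S :=
      ⟨S.erase u, notMem_erase u S, insert_erase (hAS (mem_insert_self u A))⟩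
    have hAT : A ⊆ T := (insert_subset_insert_iff hu).1 hAS
    have huA : ∀ w ∈ A, ¬ G.Adj w u := fun w hw =>
      hA (by simp [hw]) (by simp) (ne_of_mem_of_not_mem hw hu)
    have hA' : G.IsIndepSet A := hA.mono (by simp)
    set X : (V → C) → ℝ := fun f => 2 ^ #{w ∈ A | #(available G T w f) ≤ t} with hX
    have hX_insert : ∀ f, 2 ^ #{w ∈ A | #(available G (insert u T) w f) ≤ t} = X f := fun f => by
      rw [filter_congr fun w hw => by rw [available_insert (huA w hw)]]
    have hX_update : ∀ f x, X (Function.update f u x) = X f := fun f x => by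
      simp only [hX]
      rw [filter_congr fun w hw => by rw [available_update (huA w hw)]]
    simp only [two_pow_card_filter_insert hu huA, expect_add_distrib]
    calc 𝔼 f ∈ properOn G C (insert u T), X f +
          𝔼 f ∈ properOn G C (insert u T), (if #(available G T u f) ≤ t then X f else 0)
        ≤ 𝔼 f ∈ properOn G C (insert u T), X f + t / l * 𝔼 f ∈ properOn G C T, X f := by
          gcongr
          exact h.expect_ite_card_le hl huT t (fun f => by positivity) hX_update
      _ ≤ (1 + t / l) ^ #A + t / l * (1 + t / l) ^ #A := by
          gcongr
          · simpa only [hX_insert] using ih h hA' ((subset_insert u A).trans hAS)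
          · exact ih (h.mono (subset_insert u T)) hA' hAT
      _ = (1 + t / l) ^ #(insert u A) := by
          rw [card_insert_of_notMem hu]
          ring

/-- The bound of `HasMeanAvailable.expect_half_pow_card_available_le` for `k` colours and maximum
degree `d`. The first term bounds the contribution of the colourings that leave at most `t` colours
to at most `(k - n) / t` of the neighbours; the second bounds the probability of the others. -/
noncomputable def momentBound (t : ℕ) (k n l d : ℝ) : ℝ :=
  Real.exp (-(n * Real.exp (-(d * (1 + (t : ℝ)⁻¹) / n)) / 2)) +
    Real.exp (t / l * d) * 2 ^ (-((k - n) / t))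

lemma half_pow_card_available (S : Finset V) (v : V) (f : V → C) :
    (1 / 2 : ℝ) ^ #(available G S v f) =
      ∏ c, (1 - if ∀ u ∈ ({w ∈ S | G.Adj v w} : Finset V), f u ≠ c then 1 / 2 else 0) := by
  have hmem : ∀ c, (∀ u ∈ ({w ∈ S | G.Adj v w} : Finset V), f u ≠ c) ↔
      c ∈ available G S v f := by
    simp [mem_available]
  rw [← prod_const, ← Fintype.prod_ite_mem]
  refine prod_congr rfl fun c _ => ?_
  simp only [hmem]
  split_ifs <;> norm_num

lemma HasMeanAvailable.expect_half_pow_card_available_le (hG : G.CliqueFree 3)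
    (h : HasMeanAvailable G C l S) (hl : 0 < l) {t : ℕ} (ht : 1 ≤ t) {n d : ℝ} (hn : 0 < n)
    (hd : #{w ∈ S | G.Adj v w} ≤ d) :
    𝔼 f ∈ properOn G C S, (1 / 2 : ℝ) ^ #(available G S v f) ≤
      momentBound t (Fintype.card C) n l d := by
  set A : Finset V := {w ∈ S | G.Adj v w}
  have hA : G.IsIndepSet A := (SimpleGraph.isIndepSet_neighborSet_of_triangleFree _ hG v).mono
    fun w hw => (mem_filter.1 hw).2
  have hAS : A ⊆ S := filter_subset _ _
  simp only [half_pow_card_available]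
  calc 𝔼 f ∈ properOn G C S, ∏ c, (1 - if ∀ u ∈ A, f u ≠ c then (1 / 2 : ℝ) else 0)
      ≤ 𝔼 f ∈ properOn G C S,
          ∏ c, (1 - 1 / 2 * ∏ u ∈ A, (1 - uniformMass (available G S u f) c)) :=
        expect_prod_one_sub_ite_forall_le hA hAS (fun _ _ => 1 / 2) (fun _ _ _ _ => rfl)
          (fun _ _ => by norm_num) fun _ _ => by norm_num
    _ ≤ 𝔼 f ∈ properOn G C S, (Real.exp (-(n * Real.exp (-(d * (1 + (t : ℝ)⁻¹) / n)) / 2)) +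
          2 ^ #{u ∈ A | #(available G S u f) ≤ t} * 2 ^ (-((Fintype.card C - n) / t))) :=
        expect_le_expect fun f _ => prod_one_sub_half_mul_prod_le_add ht hn hd _
    _ ≤ Real.exp (-(n * Real.exp (-(d * (1 + (t : ℝ)⁻¹) / n)) / 2)) +
          (1 + t / l) ^ #A * 2 ^ (-((Fintype.card C - n) / t)) := by
        rw [expect_add_distrib, ← expect_mul]
        gcongr
        · exact expect_const_le _ (Real.exp_pos _).le
        · exact h.expect_two_pow_card_le hl hA hAS t
    _ ≤ momentBound t (Fintype.card C) n l d := by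
        unfold momentBound
        gcongr
        calc (1 + t / l) ^ #A ≤ Real.exp (t / l) ^ #A := by
              gcongr
              linarith [Real.add_one_le_exp (t / l)]
          _ = Real.exp (t / l * #A) := by rw [mul_comm, Real.exp_nat_mul]
          _ ≤ Real.exp (t / l * d) := by gcongr

lemma mul_one_sub_two_rpow_mul_half_pow_le (hl : 0 ≤ l) (a : ℕ) :
    2 * l * (1 - 2 ^ (2 * l) * (1 / 2 : ℝ) ^ a) ≤ a := by
  rcases le_total (2 * l) a with ha | ha
  · refine le_trans ?_ ha
    exact mul_le_of_le_one_right (by positivity) (sub_le_self _ (by positivity))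
  · have hone : 1 ≤ (2 : ℝ) ^ (2 * l) * (1 / 2 : ℝ) ^ a := by
      rw [one_div, inv_pow, ← div_eq_mul_inv, one_le_div (by positivity), ← Real.rpow_natCast]
      exact Real.rpow_le_rpow_of_exponent_le one_le_two ha
    exact (mul_nonpos_of_nonneg_of_nonpos (by positivity) (sub_nonpos.2 hone)).trans a.cast_nonneg

theorem hasMeanAvailable_of_momentBound [Nonempty C] (hG : G.CliqueFree 3) (hl : 0 < l) {t : ℕ}
    (ht : 1 ≤ t) {n d : ℝ} (hn : 0 < n) (hd : ∀ v, #{w | G.Adj v w} ≤ d)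
    (hB : momentBound t (Fintype.card C) n l d * 2 ^ (2 * l) ≤ 1 / 2) (S : Finset V) :
    HasMeanAvailable G C l S := by
  induction S using Finset.strongInduction with
  | H S ih =>
    intro T u hu hS
    have hT : HasMeanAvailable G C l T :=
      ih T ((ssubset_insert hu).trans_subset hS)
    have hmoment : 𝔼 f ∈ properOn G C T, (1 / 2 : ℝ) ^ #(available G T u f) ≤
        momentBound t (Fintype.card C) n l d :=
      hT.expect_half_pow_card_available_le hG hl ht hn <|
        (Nat.cast_le.2 (card_le_card (filter_subset_filter _ (subset_univ T)))).trans (hd u)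
    calc l = 2 * l * (1 - 1 / 2) := by ring
      _ ≤ 2 * l * (1 - 2 ^ (2 * l) * 𝔼 f ∈ properOn G C T, (1 / 2 : ℝ) ^ #(available G T u f)) := by
          gcongr
          refine le_trans ?_ hB
          rw [mul_comm]
          gcongr
      _ = 𝔼 f ∈ properOn G C T, 2 * l * (1 - 2 ^ (2 * l) * (1 / 2 : ℝ) ^ #(available G T u f)) := by
          rw [← mul_expect, expect_sub_distrib, ← mul_expect,
            expect_const (hT.properOn_nonempty hl)]
      _ ≤ 𝔼 f ∈ properOn G C T, (#(available G T u f) : ℝ) :=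
          expect_le_expect fun f _ => mul_one_sub_two_rpow_mul_half_pow_le hl.le _

lemma HasMeanAvailable.expect_ite_card_available_le_one (hG : G.CliqueFree 3)
    (h : HasMeanAvailable G C l S) (hl : 0 < l) {t : ℕ} (ht : 1 ≤ t) {n d : ℝ} (hn : 0 < n)
    (hu : u ∈ S) (hd : #{w ∈ S | G.Adj u w} ≤ d) :
    𝔼 f ∈ properOn G C S, (if #(available G S u f) ≤ 1 then (1 : ℝ) else 0) ≤
      2 * momentBound t (Fintype.card C) n l d / l := by
  obtain ⟨T, huT, rfl⟩ : ∃ T, u ∉ T ∧ insert u T = S :=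
    ⟨S.erase u, notMem_erase u S, insert_erase hu⟩
  simp only [available_insert G.irrefl]
  rw [le_div_iff₀' hl]
  calc l * 𝔼 f ∈ properOn G C (insert u T), (if #(available G T u f) ≤ 1 then (1 : ℝ) else 0)
      ≤ 𝔼 f ∈ properOn G C T,
          #(available G T u f) * (if #(available G T u f) ≤ 1 then (1 : ℝ) else 0) :=
        h.mul_expect_le huT (fun f => by positivity) fun f x => by rw [available_update G.irrefl]
    _ ≤ 𝔼 f ∈ properOn G C T, 2 * (1 / 2 : ℝ) ^ #(available G T u f) := by
        refine expect_le_expect fun f _ => ?_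
        split_ifs with hcard
        · interval_cases #(available G T u f) <;> norm_num
        · simp
    _ ≤ 2 * momentBound t (Fintype.card C) n l d := by
        rw [← mul_expect]
        gcongr
        refine (h.mono (subset_insert u T)).expect_half_pow_card_available_le hG hl ht hn ?_
        exact (Nat.cast_le.2 (card_le_card (filter_subset_filter _ (subset_insert u T)))).trans hd

end RandomColourings

section Recolouring

variable {V C : Type*} {G : SimpleGraph V}

lemma hammingDist_le_card_of_forall_notMem [Fintype V] [DecidableEq C] {s : Finset V}
    {f g : V → C} (h : ∀ u ∉ s, f u = g u) : hammingDist f g ≤ #s :=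
  card_le_card fun u hu => by_contra fun hus => (mem_filter.1 hu).2 (h u hus)

/-- The colouring obtained from `τ` by giving `u` the colour `c`, which no neighbour of `u` has. -/
def recolour [DecidableEq V] (τ : G.Coloring C) (u : V) (c : C)
    (hc : ∀ w, G.Adj u w → τ w ≠ c) : G.Coloring C :=
  .mk (Function.update τ u c) fun {a b} hab => by
    rcases eq_or_ne a u with rfl | ha
    · simpa [hab.ne'] using (hc b hab).symm
    · rcases eq_or_ne b u with rfl | hb
      · simpa [ha] using hc a hab.symm
      · simpa [ha, hb] using τ.valid hab

lemma coe_recolour [DecidableEq V] (τ : G.Coloring C) (u : V) (c : C)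
    (hc : ∀ w, G.Adj u w → τ w ≠ c) : ⇑(recolour τ u c hc) = Function.update τ u c := rfl

variable [Fintype V] {k : ℕ} {τ σ : G.Coloring (Fin k)} {u v : V} {c : Fin k}

lemma colouringGraph_adj_recolour [DecidableEq V] (hc : ∀ w, G.Adj u w → τ w ≠ c)
    (hcu : c ≠ τ u) : (colouringGraph G k 1).Adj τ (recolour τ u c hc) := by
  refine ⟨fun h => hcu ?_, hammingDist_le_card_of_forall_notMem (s := {u}) fun w hw => ?_⟩
  · simpa [coe_recolour] using (DFunLike.congr_fun h u).symm
  · simp only [coe_recolour, Function.update_of_ne (notMem_singleton.1 hw)]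

/-- `σ` arises from `τ` by recolouring, one vertex at a time and through proper colourings, only
`v` and its neighbours. -/
def IsLocallyReachable (v : V) (τ σ : G.Coloring (Fin k)) : Prop :=
  ∃ w : (colouringGraph G k 1).Walk τ σ,
    ∀ ρ ∈ w.support, ∀ u : V, u ≠ v → ¬ G.Adj v u → ρ u = τ u

lemma IsLocallyReachable.refl (v : V) (τ : G.Coloring (Fin k)) : IsLocallyReachable v τ τ :=
  ⟨.nil, by simp⟩

lemma IsLocallyReachable.of_recolour [DecidableEq V] (hu : u = v ∨ G.Adj v u)
    (hc : ∀ w, G.Adj u w → τ w ≠ c)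
    (h : IsLocallyReachable v (recolour τ u c hc) σ) : IsLocallyReachable v τ σ := by
  rcases eq_or_ne c (τ u) with rfl | hcu
  · rwa [show recolour τ u (τ u) hc = τ from DFunLike.coe_injective (Function.update_eq_self u τ)]
      at h
  obtain ⟨p, hp⟩ := h
  refine ⟨.cons (colouringGraph_adj_recolour hc hcu) p, fun ρ hρ w hwv hvw => ?_⟩
  have hwu : w ≠ u := by
    rintro rfl
    exact hu.elim hwv hvw
  rcases List.mem_cons.1 hρ with rfl | hρ
  · rfl
  · rw [hp ρ hρ w hwv hvw, coe_recolour, Function.update_of_ne hwu]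

/-- A neighbour of `v` that has the colour `j` steps aside to a second available colour. As `v` is
in no triangle, this does not affect the colours available to the other neighbours. -/
lemma exists_isLocallyReachable [DecidableRel G.Adj] (hG : G.CliqueFree 3)
    (τ : G.Coloring (Fin k)) (v : V) (j : Fin k)
    (havail : ∀ u, G.Adj v u → 1 < #(available G univ u τ)) :
    ∃ σ : G.Coloring (Fin k), IsLocallyReachable v τ σ ∧ σ v = j := by
  classical
  induction hm : #{u | G.Adj v u ∧ τ u = j} using Nat.strong_induction_on generalizing τ with
  | h m ih =>
    by_cases hfree : ∀ u, G.Adj v u → τ u ≠ j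
    · exact ⟨recolour τ v j hfree, .of_recolour (.inl rfl) hfree (.refl _ _), by
        rw [coe_recolour, Function.update_self]⟩
    push Not at hfree
    obtain ⟨u, hvu, hu⟩ := hfree
    obtain ⟨c, hc, hcj⟩ := exists_mem_ne (havail u hvu) j
    have hc' : ∀ w, G.Adj u w → τ w ≠ c := fun w => mem_available.1 hc w (mem_univ w)
    have hindep := SimpleGraph.isIndepSet_neighborSet_of_triangleFree _ hG v
    have havail' : ∀ w, G.Adj v w → 1 < #(available G univ w (recolour τ u c hc')) := by
      intro w hvw
      have hwu : ¬ G.Adj w u := fun hwu => hindep hvw hvu hwu.ne hwu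
      rw [coe_recolour, available_update hwu]
      exact havail w hvw
    have hlt : #{w | G.Adj v w ∧ recolour τ u c hc' w = j} < m := by
      rw [← hm]
      refine card_lt_card ((ssubset_iff_of_subset fun w hw => ?_).2
        ⟨u, by simp [hvu, hu], fun h => hcj ?_⟩)
      · obtain ⟨hvw, hw⟩ := (mem_filter_univ _).1 hw
        have hwu : w ≠ u := by
          rintro rfl
          exact hcj (by simpa [coe_recolour] using hw)
        rw [coe_recolour, Function.update_of_ne hwu] at hw
        exact (mem_filter_univ _).2 ⟨hvw, hw⟩
      · simpa [coe_recolour] using ((mem_filter_univ _).1 h).2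
    obtain ⟨σ, hσ, hσv⟩ := ih _ hlt _ havail' rfl
    exact ⟨σ, hσ.of_recolour (.inr hvu) hc', hσv⟩

lemma isLoose_and_isThawed_and_isLocallyRecolourable [DecidableRel G.Adj] (hG : G.CliqueFree 3)
    {d : ℕ} (hd : G.degree v ≤ d) (havail : ∀ u, G.Adj v u → 1 < #(available G univ u τ)) :
    IsLoose G k (d + 1) τ v ∧ IsThawed G k 1 τ v ∧ IsLocallyRecolourable G k τ v := by
  classical
  have hreach := fun j => exists_isLocallyReachable hG τ v j havail
  refine ⟨fun j hj => ?_, fun j => ?_, fun j => ?_⟩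
  · obtain ⟨σ, ⟨p, hp⟩, rfl⟩ := hreach j
    refine ⟨σ, ⟨fun h => hj (by rw [h]), ?_⟩, rfl⟩
    calc hammingDist τ σ ≤ #(insert v (G.neighborFinset v)) := by
          refine hammingDist_le_card_of_forall_notMem fun u hu => ?_
          rw [mem_insert, G.mem_neighborFinset, not_or] at hu
          exact (hp σ p.end_mem_support u hu.1 hu.2).symm
      _ ≤ G.degree v + 1 := card_insert_le _ _
      _ ≤ d + 1 := by gcongr
  · obtain ⟨σ, ⟨p, -⟩, hσ⟩ := hreach j
    exact ⟨σ, SimpleGraph.ConnectedComponent.sound p.reachable.symm, hσ⟩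
  · obtain ⟨σ, ⟨p, hp⟩, hσ⟩ := hreach j
    exact ⟨σ, p, hσ, hp⟩

end Recolouring

section Probability

variable {V : Type*} [Fintype V] {G : SimpleGraph V} {k : ℕ}

lemma expect_coloring [DecidableEq V] [DecidableRel G.Adj] {C : Type*} [Fintype C]
    [DecidableEq C] [Fintype (G.Coloring C)] (X : (V → C) → ℝ) :
    𝔼 τ : G.Coloring C, X τ = 𝔼 f ∈ properOn G C univ, X f := by
  refine expect_nbij (⇑) (fun τ _ => mem_properOn.2 fun _ _ _ _ h => τ.valid h) (fun _ _ => rfl)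
    DFunLike.coe_injective.injOn fun f hf => ?_
  exact ⟨.mk f fun {u w} h => mem_properOn.1 hf u (mem_univ u) w (mem_univ w) h, mem_univ _, rfl⟩

lemma one_sub_expect_le_colouringProb [DecidableEq V] [DecidableRel G.Adj]
    [Nonempty (G.Coloring (Fin k))] {E : Set (G.Coloring (Fin k))} {X : (V → Fin k) → ℝ}
    (hX0 : ∀ f, 0 ≤ X f) (hX : ∀ τ : G.Coloring (Fin k), τ ∉ E → 1 ≤ X τ) :
    1 - 𝔼 f ∈ properOn G (Fin k) univ, X f ≤ colouringProb G k E := by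
  classical
  have : Finite (G.Coloring (Fin k)) := DFunLike.finite _
  let _ : Fintype (G.Coloring (Fin k)) := Fintype.ofFinite _
  calc 1 - 𝔼 f ∈ properOn G (Fin k) univ, X f = 𝔼 τ : G.Coloring (Fin k), (1 - X τ) := by
        rw [← expect_coloring, expect_sub_distrib, Fintype.expect_const]
    _ ≤ 𝔼 τ : G.Coloring (Fin k), (if τ ∈ E then 1 else 0 : ℝ) := by
        refine expect_le_expect fun τ _ => ?_
        split_ifs with hτ
        exacts [sub_le_self 1 (hX0 τ), sub_nonpos.2 (hX τ hτ)]
    _ = colouringProb G k E := by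
        rw [colouringProb, uniformColouring, PMF.toOuterMeasure_uniformOfFintype_apply,
          ENNReal.toReal_div, ENNReal.toReal_natCast, ENNReal.toReal_natCast,
          Fintype.card_subtype, expect_eq_sum_div_card, sum_boole, card_univ]

theorem exists_coloring_and_le_colouringProb [NeZero k] [DecidableRel G.Adj]
    (hG : G.CliqueFree 3) {d : ℕ} (hd : G.maxDegree ≤ d) {t : ℕ} (ht : 1 ≤ t) {n l : ℝ}
    (hn : 0 < n) (hl : 0 < l) (hB : momentBound t k n l d * 2 ^ (2 * l) ≤ 1 / 2) :
    ∃ _ : Nonempty (G.Coloring (Fin k)), ∀ v : V,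
      1 - d * (2 * momentBound t k n l d / l) ≤ colouringProb G k
        {τ | IsLoose G k (d + 1) τ v ∧ IsThawed G k 1 τ v ∧ IsLocallyRecolourable G k τ v} := by
  classical
  have hdeg : ∀ v, G.degree v ≤ d := fun v => (G.degree_le_maxDegree v).trans hd
  have hcard : ∀ v, (#{w | G.Adj v w} : ℝ) ≤ d := fun v => by
    rw [← SimpleGraph.neighborFinset_eq_filter, SimpleGraph.card_neighborFinset_eq_degree]
    exact_mod_cast hdeg v
  have hmean : HasMeanAvailable G (Fin k) l univ :=
    hasMeanAvailable_of_momentBound hG hl ht hn hcard (by rwa [Fintype.card_fin]) univ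
  obtain ⟨f, hf⟩ := hmean.properOn_nonempty hl
  have hne : Nonempty (G.Coloring (Fin k)) :=
    ⟨.mk f fun {u w} h => mem_properOn.1 hf u (mem_univ u) w (mem_univ w) h⟩
  refine ⟨hne, fun v => ?_⟩
  set stuck : V → (V → Fin k) → ℝ := fun u f => if #(available G univ u f) ≤ 1 then 1 else 0
  have hstuck : ∀ u f, 0 ≤ stuck u f := fun u f => by positivity
  have hunion : 𝔼 f ∈ properOn G (Fin k) univ, ∑ u with G.Adj v u, stuck u f ≤
      d * (2 * momentBound t k n l d / l) := by
    rw [expect_sum_comm]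
    calc ∑ u with G.Adj v u, 𝔼 f ∈ properOn G (Fin k) univ, stuck u f
        ≤ ∑ u with G.Adj v u, 2 * momentBound t k n l d / l := by
          refine sum_le_sum fun u _ => ?_
          simpa only [Fintype.card_fin] using
            hmean.expect_ite_card_available_le_one hG hl ht hn (mem_univ u) (hcard u)
      _ ≤ d * (2 * momentBound t k n l d / l) := by
          rw [sum_const, nsmul_eq_mul]
          refine mul_le_mul_of_nonneg_right (hcard v) ?_
          unfold momentBound
          positivity
  refine (sub_le_sub_left hunion 1).trans (one_sub_expect_le_colouringProb
    (fun f => sum_nonneg fun u _ => hstuck u f) fun τ hτ => ?_)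
  obtain ⟨u, hvu, hu⟩ : ∃ u, G.Adj v u ∧ #(available G univ u τ) ≤ 1 := by
    by_contra! havail
    exact hτ (isLoose_and_isThawed_and_isLocallyRecolourable hG (hdeg v) havail)
  calc 1 = stuck u τ := (if_pos hu).symm
    _ ≤ ∑ u with G.Adj v u, stuck u τ :=
        single_le_sum (fun u _ => hstuck u τ) ((mem_filter_univ u).2 hvu)

end Probability

section Asymptotics

open Filter

lemma eventually_log_rpow_le_mul_rpow (r : ℝ) {s c : ℝ} (hs : 0 < s) (hc : 0 < c) :
    ∀ᶠ x : ℝ in atTop, Real.log x ^ r ≤ c * x ^ s := by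
  filter_upwards [(isLittleO_log_rpow_rpow_atTop r hs).bound hc, eventually_ge_atTop 0]
    with x hx hx0
  rw [Real.norm_of_nonneg (Real.rpow_nonneg hx0 s)] at hx
  exact (le_abs_self _).trans hx

lemma eventually_rpow_le_mul {s c : ℝ} (hs : s < 1) (hc : 0 < c) :
    ∀ᶠ x : ℝ in atTop, x ^ s ≤ c * x := by
  filter_upwards [(tendsto_rpow_atTop (sub_pos.2 hs)).eventually_ge_atTop c⁻¹,
    eventually_gt_atTop 0] with x hx hx0
  rwa [Real.rpow_sub hx0, Real.rpow_one, le_div_iff₀ (by positivity),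
    inv_mul_le_iff₀ hc] at hx

lemma rpow_div_four_le_mul_exp {ε s k d : ℝ} (hε : 0 < ε) (hε1 : ε ≤ 1) (hs0 : 0 ≤ s)
    (hs : s ≤ ε / 4) (hk : 1 ≤ k) (hd : d ≤ (1 - ε) * k * Real.log k) :
    k ^ (ε / 2) / 4 ≤
      (1 - ε / 6) * k * Real.exp (-(d * (1 + s) / ((1 - ε / 6) * k))) / 2 := by
  have hk0 : 0 < k := by linarith
  have hlog : 0 ≤ Real.log k := Real.log_nonneg hk
  have hhalf : 1 / 2 ≤ 1 - ε / 6 := by linarith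
  have hexponent : d * (1 + s) / ((1 - ε / 6) * k) ≤ (1 - ε / 2) * Real.log k := by
    rw [div_le_iff₀ (by positivity)]
    calc d * (1 + s) ≤ ((1 - ε) * k * Real.log k) * (1 + ε / 4) := by gcongr
      _ = ((1 - ε) * (1 + ε / 4)) * (k * Real.log k) := by ring
      _ ≤ ((1 - ε / 2) * (1 - ε / 6)) * (k * Real.log k) := by
          refine mul_le_mul_of_nonneg_right ?_ (by positivity)
          nlinarith
      _ = (1 - ε / 2) * Real.log k * ((1 - ε / 6) * k) := by ring
  have hpow : k ^ (ε / 2) = k * Real.exp (-((1 - ε / 2) * Real.log k)) := by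
    rw [← mul_neg_one, mul_right_comm, mul_comm _ (Real.log k), ← Real.rpow_def_of_pos hk0,
      ← Real.rpow_one_add' hk0.le (by linarith)]
    ring_nf
  calc k ^ (ε / 2) / 4 = 1 / 2 * k * Real.exp (-((1 - ε / 2) * Real.log k)) / 2 := by
        rw [hpow]; ring
    _ ≤ (1 - ε / 6) * k * Real.exp (-(d * (1 + s) / ((1 - ε / 6) * k))) / 2 := by gcongr

lemma eventually_div_log_sq_mul_sub_le {a s t : ℝ} (ha : 0 < a) (hs : s < 1) (ht : 0 ≤ t) :
    ∀ᶠ k : ℝ in atTop, ∀ d ≤ k * Real.log k,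
      t / Real.log k ^ 2 * d + -(a * k) * Real.log 2 ≤ -(k ^ s / 4) := by
  filter_upwards [eventually_gt_atTop 1, eventually_rpow_le_mul hs ha,
    Real.tendsto_log_atTop.eventually_ge_atTop (4 * t / a)] with k hk hpow hlog d hd
  have hk0 : 0 < k := by linarith
  have hlog0 : 0 < Real.log k := Real.log_pos hk
  have hgain : t / Real.log k ^ 2 * d ≤ a / 4 * k :=
    calc t / Real.log k ^ 2 * d ≤ t / Real.log k ^ 2 * (k * Real.log k) := by gcongr
      _ = t / Real.log k * k := by field_simp
      _ ≤ a / 4 * k := by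
          rw [div_le_iff₀ ha] at hlog
          refine mul_le_mul_of_nonneg_right ?_ hk0.le
          rw [div_le_iff₀ hlog0]
          linarith
  have hlogtwo : a * k * (1 / 2) ≤ a * k * Real.log 2 := by
    gcongr
    linarith [Real.log_two_gt_d9]
  linarith

lemma eventually_momentBound_le {ε : ℝ} (hε : 0 < ε) (hε1 : ε ≤ 1) {t : ℕ} (ht : 4 / ε ≤ t) :
    ∀ᶠ k : ℝ in atTop, ∀ d ≤ (1 - ε) * k * Real.log k,
      momentBound t k ((1 - ε / 6) * k) (Real.log k ^ 2) d ≤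
        2 * Real.exp (-(k ^ (ε / 2) / 4)) := by
  have ht0 : (0 : ℝ) < t := (by positivity : 0 < 4 / ε).trans_le ht
  have htinv : (t : ℝ)⁻¹ ≤ ε / 4 := by
    rwa [inv_le_comm₀ ht0 (by positivity), inv_div]
  filter_upwards [eventually_ge_atTop 1, eventually_div_log_sq_mul_sub_le
    (a := ε / 6 / t) (s := ε / 2) (by positivity) (by linarith) ht0.le] with k hk hgain d hd
  have hd' : d ≤ k * Real.log k := by
    linarith [mul_nonneg hε.le (mul_nonneg (zero_le_one.trans hk) (Real.log_nonneg hk))]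
  rw [momentBound, two_mul, Real.rpow_def_of_pos two_pos, ← Real.exp_add]
  have hcoef : (k - (1 - ε / 6) * k) / t = ε / 6 / t * k := by ring
  refine add_le_add (Real.exp_le_exp.2 <| neg_le_neg <|
    rpow_div_four_le_mul_exp hε hε1 (by positivity) htinv hk hd) (Real.exp_le_exp.2 ?_)
  rw [hcoef, mul_comm (Real.log 2)]
  exact hgain d hd'

lemma eventually_exp_neg_rpow_mul_two_rpow_le {s : ℝ} (hs : 0 < s) :
    ∀ᶠ x : ℝ in atTop,
      2 * Real.exp (-(x ^ s / 4)) * 2 ^ (2 * Real.log x ^ 2) ≤ 1 / 2 := by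
  filter_upwards [eventually_log_rpow_le_mul_rpow 2 hs (by norm_num : (0 : ℝ) < 1 / 16),
    (tendsto_rpow_atTop hs).eventually_ge_atTop (8 * Real.log 4)] with x hlog hx
  rw [Real.rpow_two] at hlog
  have hlogtwo : Real.log 2 * (2 * Real.log x ^ 2) ≤ 1 * (2 * Real.log x ^ 2) := by
    gcongr
    linarith [Real.log_two_lt_d9]
  calc 2 * Real.exp (-(x ^ s / 4)) * 2 ^ (2 * Real.log x ^ 2)
      = 2 * Real.exp (-(x ^ s / 4) + Real.log 2 * (2 * Real.log x ^ 2)) := by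
        rw [Real.exp_add, Real.rpow_def_of_pos two_pos, mul_assoc]
    _ ≤ 2 * Real.exp (-Real.log 4) := by
        gcongr
        linarith
    _ = 1 / 2 := by
        rw [Real.exp_neg, Real.exp_log (by norm_num)]
        norm_num

lemma eventually_mul_exp_neg_rpow_le {r s : ℝ} (hr : 0 ≤ r) (hrs : r < s) :
    ∀ᶠ x : ℝ in atTop, ∀ d, 0 ≤ d → d ≤ x * Real.log x →
      d * (2 * (2 * Real.exp (-(x ^ s / 4))) / Real.log x ^ 2) ≤ Real.exp (-(d ^ r)) := by
  have hs : 0 < s := hr.trans_lt hrs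
  filter_upwards [eventually_gt_atTop 0, Real.tendsto_log_atTop.eventually_ge_atTop 4,
    eventually_log_rpow_le_mul_rpow r (sub_pos.2 hrs) (by norm_num : (0 : ℝ) < 1 / 8),
    eventually_log_rpow_le_mul_rpow 1 hs (by norm_num : (0 : ℝ) < 1 / 8)]
    with x hx hlog hlogr hlogs d hd0 hd
  have hlog0 : 0 < Real.log x := by linarith
  rw [Real.rpow_one] at hlogs
  have hdr : d ^ r ≤ x ^ s / 8 :=
    calc d ^ r ≤ (x * Real.log x) ^ r := by gcongr
      _ = x ^ r * Real.log x ^ r := Real.mul_rpow hx.le hlog0.le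
      _ ≤ x ^ r * (1 / 8 * x ^ (s - r)) := by gcongr
      _ = x ^ s / 8 := by rw [Real.rpow_sub hx]; field_simp
  calc d * (2 * (2 * Real.exp (-(x ^ s / 4))) / Real.log x ^ 2)
      ≤ x * Real.log x * (2 * (2 * Real.exp (-(x ^ s / 4))) / Real.log x ^ 2) := by gcongr
    _ = 4 / Real.log x * (x * Real.exp (-(x ^ s / 4))) := by field_simp; norm_num
    _ ≤ 1 * (x * Real.exp (-(x ^ s / 4))) := by
        gcongr
        rwa [div_le_one hlog0]
    _ = Real.exp (Real.log x - x ^ s / 4) := by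
        rw [one_mul, sub_eq_add_neg, Real.exp_add, Real.exp_log hx]
    _ ≤ Real.exp (-(d ^ r)) := by
        gcongr
        linarith

lemma eventually_exists_momentBound_le {ε : ℝ} (hε : 0 < ε) :
    ∀ᶠ k : ℕ in atTop, ∀ d : ℝ, 0 ≤ d → d ≤ (1 - ε) * k * Real.log k →
      ∃ (t : ℕ) (n l : ℝ), 1 ≤ t ∧ 0 < n ∧ 0 < l ∧ momentBound t k n l d * 2 ^ (2 * l) ≤ 1 / 2 ∧
        d * (2 * momentBound t k n l d / l) ≤ Real.exp (-(d ^ (ε / 3))) := by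
  have ht : 4 / ε ≤ (⌈4 / ε⌉₊ : ℝ) := Nat.le_ceil _
  have hreal : ∀ᶠ x : ℝ in atTop, ∀ d : ℝ, 0 ≤ d → d ≤ (1 - ε) * x * Real.log x →
      ∃ (t : ℕ) (n l : ℝ), 1 ≤ t ∧ 0 < n ∧ 0 < l ∧ momentBound t x n l d * 2 ^ (2 * l) ≤ 1 / 2 ∧
        d * (2 * momentBound t x n l d / l) ≤ Real.exp (-(d ^ (ε / 3))) := by
    rcases lt_or_ge 1 ε with hε1 | hε1
    · filter_upwards [eventually_gt_atTop 1] with x hx d hd0 hd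
      have hpos : 0 < (ε - 1) * (x * Real.log x) :=
        mul_pos (sub_pos.2 hε1) (mul_pos (by linarith) (Real.log_pos hx))
      linarith
    filter_upwards [eventually_gt_atTop 1, eventually_momentBound_le hε hε1 ht,
      eventually_exp_neg_rpow_mul_two_rpow_le (half_pos hε),
      eventually_mul_exp_neg_rpow_le (r := ε / 3) (s := ε / 2) (by positivity) (by linarith)]
      with x hx hmoment hhalf hexp d hd0 hd
    have hlog : 0 < Real.log x := Real.log_pos hx
    have hd' : d ≤ x * Real.log x := by
      linarith [mul_pos hε (mul_pos (one_pos.trans hx) hlog)]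
    have hB := hmoment d hd
    refine ⟨⌈4 / ε⌉₊, (1 - ε / 6) * x, Real.log x ^ 2, Nat.ceil_pos.2 (by positivity),
      mul_pos (by linarith) (by linarith), by positivity, le_trans ?_ hhalf,
      le_trans ?_ (hexp d hd0 hd')⟩ <;> gcongr
  exact tendsto_natCast_atTop_atTop.eventually hreal

end Asymptotics

end ColouringGeometry

/-- The uniform distribution only makes sense if `G` has a proper `k`-colouring; that there is one
is part of the claim. -/
theorem mainTheorem3 (ε : ℝ) (hε : 0 < ε) :
    ∀ᶠ k : ℕ in Filter.atTop, ∀ Δ : ℕ, (Δ : ℝ) ≤ (1 - ε) * k * Real.log k →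
      ∀ (V : Type*) [Fintype V] (G : SimpleGraph V) [DecidableRel G.Adj],
        G.CliqueFree 3 → G.maxDegree ≤ Δ →
        ∃ _ : Nonempty (G.Coloring (Fin k)), ∀ v : V,
          1 - Real.exp (-((Δ : ℝ) ^ (ε / 3))) ≤
            ColouringGeometry.colouringProb G k
              {τ | ColouringGeometry.IsLoose G k (Δ + 1) τ v ∧
                ColouringGeometry.IsThawed G k 1 τ v ∧
                ColouringGeometry.IsLocallyRecolourable G k τ v} := by
  filter_upwards [ColouringGeometry.eventually_exists_momentBound_le hε,
    Filter.eventually_ne_atTop 0] with k hk hk0 Δ hΔ V _ G _ hG hdeg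
  have : NeZero k := ⟨hk0⟩
  obtain ⟨t, n, l, ht, hn, hl, hhalf, hfail⟩ := hk Δ Δ.cast_nonneg hΔ
  obtain ⟨hne, hprob⟩ :=
    ColouringGeometry.exists_coloring_and_le_colouringProb hG hdeg ht hn hl hhalf
  exact ⟨hne, fun v => (sub_le_sub_left hfail 1).trans (hprob v)⟩
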